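/- Let $X\neq\{0\}$ be a complex Banach space with closed unit ball $B_X$ and unit sphere $S_X$, and let $X^*$ be its dual, with closed unit ball $B_{X^*}$. Let $\mathcal A_u(B_X:X)$ be the space of all bounded, uniformly continuous functions $f:B_X\to X$ that are holomorphic on the interior of $B_X$, with the norm $\|f\|=\sup_{x\in B_X}\|f(x)\|$. Let $\Pi(X)=\{(x,x^*)\in B_X\times B_{X^*}: x^*(x)=1\}$, with the topology induced by the norm topology on $B_X$ and the weak-$*$ topology on $B_{X^*}$, and put $v(f)=\sup\{|x^*(f(x))|:(x,x^*)\in\Pi(X)\}$. A nonzero $f\in\mathcal A_u(B_X:X)$ is a *(norm) strong peak function* if there is $t\in B_X$ such that every sequence $(t_n)$ in $B_X$ with $\lim_n\|f(t_n)\|=\|f\|$ converges to $t$. A function $f\in\mathcal A_u(B_X:X)$ is a *numerical strong peak function* if there is $(x,x^*)\in\Pi(X)$ such that every sequence $((x_n,x_n^*))$ in $\Pi(X)$ with $\lim_n|x_n^*(f(x_n))|=v(f)$ converges to $(x,x^*)$ in $\Pi(X)$. Suppose that $X$ is separable, smooth (for every $x\in S_X$ there is exactly one $x^*\in B_{X^*}$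 with $\operatorname{Re}x^*(x)=1$) and locally uniformly convex (for every $x\in S_X$ and $\varepsilon>0$ there is $\delta>0$ such that $\|x+y\|\le 2-\delta$ for all $y\in S_X$ with $\|x-y\|\ge\varepsilon$). Then the set of all functions in $\mathcal A_u(B_X:X)$ that are both norm strong peak functions and numerical strong peak functions is a dense $G_\delta$ subset of $\mathcal A_u(B_X:X)$. -/

import Mathlib

open Filter Topology Metric Set
open scoped BoundedContinuousFunction

noncomputable section

/-- The set `sm(B_X)` of smooth points of the closed unit ball: those `x ∈ B_X` for which there is
exactly one `x' ∈ B_{X*}` with `Re x'(x) = 1`. -/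
def smoothPoints (X : Type*) [NormedAddCommGroup X] [NormedSpace ℂ X] : Set X :=
  {x | x ∈ closedBall (0 : X) 1 ∧
    ∃! x' : StrongDual ℂ X, x' ∈ closedBall (0 : StrongDual ℂ X) 1 ∧ (x' x).re = 1}

/-- `X` is smooth if every point of its unit sphere is a smooth point: `sm(B_X) = S_X`. -/
def IsSmoothSpace (X : Type*) [NormedAddCommGroup X] [NormedSpace ℂ X] : Prop :=
  smoothPoints X = sphere (0 : X) 1

/-- Local uniform convexity (local uniform rotundity) of the norm: for each unit vector `x` and
`ε > 0` there is `δ > 0` such that `‖x - y‖ ≥ ε`, `‖y‖ = 1` imply `‖x + y‖ ≤ 2 - δ`. -/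
def IsLocallyUniformlyConvex (X : Type*) [NormedAddCommGroup X] : Prop :=
  ∀ x : X, ‖x‖ = 1 → ∀ ε : ℝ, 0 < ε → ∃ δ : ℝ, 0 < δ ∧
    ∀ y : X, ‖y‖ = 1 → ε ≤ ‖x - y‖ → ‖x + y‖ ≤ 2 - δ

/-- The unit ball `B_X` as a metric space (it is closed). -/
abbrev UnitBall (X : Type*) [NormedAddCommGroup X] : Type _ :=
  ↥(closedBall (0 : X) 1)

/-- `f : B_X → X` is holomorphic on the interior of `B_X` (complex Fréchet differentiable there;
the value `0` given to the extension outside `B_X` plays no role on that open set). -/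
def IsHolomorphicOnInterior {X : Type*} [NormedAddCommGroup X] [NormedSpace ℂ X]
    (f : UnitBall X → X) : Prop :=
  DifferentiableOn ℂ (Function.extend (Subtype.val : UnitBall X → X) f 0)
    (interior (closedBall (0 : X) 1))

theorem extend_val_apply {X : Type*} [NormedAddCommGroup X] (f : UnitBall X → X) {x : X}
    (hx : x ∈ closedBall (0 : X) 1) :
    Function.extend (Subtype.val : UnitBall X → X) f 0 x = f ⟨x, hx⟩ :=
  Subtype.val_injective.extend_apply f 0 (⟨x, hx⟩ : UnitBall X)

/-- The space `A_b(B_X : X)` of bounded continuous functions `B_X → X` that are holomorphic on the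
interior of `B_X`, with the sup norm. -/
def HolBall (X : Type*) [NormedAddCommGroup X] [NormedSpace ℂ X] : Submodule ℂ (UnitBall X →ᵇ X) where
  carrier := {f | IsHolomorphicOnInterior (f : UnitBall X → X)}
  zero_mem' := by
    refine (differentiableOn_const (0 : X)).congr fun x hx => ?_
    rw [extend_val_apply _ (interior_subset hx)]; rfl
  add_mem' := by
    intro f g hf hg
    refine (DifferentiableOn.add hf hg).congr fun x hx => ?_
    rw [Pi.add_apply]
    simp only [extend_val_apply _ (interior_subset hx)]; rfl
  smul_mem' := by
    intro c f hf
    refine (DifferentiableOn.const_smul hf c).congr fun x hx => ?_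
    rw [Pi.smul_apply]
    simp only [extend_val_apply _ (interior_subset hx)]; rfl

/-- The space `A_u(B_X : X)` of those elements of `A_b(B_X : X)` that are uniformly continuous on
`B_X`, with the sup norm. -/
def UnifHolBall (X : Type*) [NormedAddCommGroup X] [NormedSpace ℂ X] : Submodule ℂ (UnitBall X →ᵇ X) where
  carrier := {f | f ∈ HolBall X ∧ UniformContinuous (f : UnitBall X → X)}
  zero_mem' := ⟨(HolBall X).zero_mem, uniformContinuous_const⟩
  add_mem' := fun hf hg => ⟨(HolBall X).add_mem hf.1 hg.1, hf.2.add hg.2⟩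
  smul_mem' := fun c _ hf => ⟨(HolBall X).smul_mem c hf.1, hf.2.const_smul c⟩

/-- A (norm) strong peak function on a metric space `K`: a nonzero `f` such that, for some `t : K`,
every sequence along which `‖f‖` tends to the sup norm of `f` converges to `t`. -/
def IsStrongPeakFunction {K Y : Type*} [PseudoMetricSpace K] [NormedAddCommGroup Y]
    (f : K →ᵇ Y) : Prop :=
  f ≠ 0 ∧ ∃ t : K, ∀ u : ℕ → K,
    Tendsto (fun n => ‖f (u n)‖) atTop (𝓝 ‖f‖) → Tendsto u atTop (𝓝 t)

/-- `Π(X) = {(x, x') ∈ B_X × B_{X*} : x'(x) = 1}`, as a subspace of the product of `X` with the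
norm topology and `X*` with the weak-* topology. -/
def numPi (X : Type*) [NormedAddCommGroup X] [NormedSpace ℂ X] : Set (X × WeakDual ℂ X) :=
  {p | p.1 ∈ closedBall (0 : X) 1 ∧
    WeakDual.toStrongDual p.2 ∈ closedBall (0 : StrongDual ℂ X) 1 ∧ p.2 p.1 = 1}

/-- The number `|x'(f(x))|` for `(x, x') ∈ Π(X)`. -/
def numValue {X : Type*} [NormedAddCommGroup X] [NormedSpace ℂ X]
    (f : UnitBall X →ᵇ X) (p : numPi X) : ℝ :=
  ‖p.1.2 (f ⟨p.1.1, p.2.1⟩)‖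

/-- The numerical radius `v(f) = sup {|x'(f(x))| : (x, x') ∈ Π(X)}`; the set is bounded above by
the sup norm of `f`, and nonempty when `X ≠ 0`. -/
def numRadius {X : Type*} [NormedAddCommGroup X] [NormedSpace ℂ X] (f : UnitBall X →ᵇ X) : ℝ :=
  ⨆ p : numPi X, numValue f p

/-- A numerical strong peak function: for some `(x, x') ∈ Π(X)`, every sequence in `Π(X)` along
which `|x'(f(x))|` tends to `v(f)` converges to `(x, x')` in `Π(X)`. -/
def IsNumericalStrongPeakFunction {X : Type*} [NormedAddCommGroup X] [NormedSpace ℂ X]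
    (f : UnitBall X →ᵇ X) : Prop :=
  ∃ t : numPi X, ∀ u : ℕ → numPi X,
    Tendsto (fun n => numValue f (u n)) atTop (𝓝 (numRadius f)) → Tendsto u atTop (𝓝 t)

end

/-!
Both kinds of strong peak function are instances of one scheme: a family of functions
`val f : P → ℝ`, each bounded above and `1`-Lipschitz in `f` for the sup norm, together with a
position map `pos : P → Z` into a complete metric space. That every maximizing sequence of `val f`
has convergent positions, with a common limit, is equivalent to `f` lying in the sets
`nearlyPeaking val pos (1 / (n + 1))` for all `n` (`forall_mem_nearlyPeaking_iff`), and these sets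
are open. For norm peaks, `val f x = ‖f x‖` and `pos` is the identity of `B_X`. For numerical peaks,
`val f (x, x') = |x'(f x)|` and `pos` is the projection `Π(X) → S_X`; smoothness and weak-*
compactness of the dual ball make convergence in `Π(X)` the same as convergence of the first
coordinates (`IsSmoothSpace.tendsto_numPi_iff`).

The sets are dense because every `x ∈ S_X` is a peak point: if `x'` is a norm-one functional with
`x'(x) = 1`, local uniform convexity makes `|1 + x'(y)| / 2 ≤ ‖x + y‖ / 2` stay below some constant
less than `1` away from `x`, so that high powers of `(1 + x') / 2` are as small there as needed
(`exists_peak_unifHolBall`). Given `f`, one takes an almost maximizing point over some `x ∈ S_X`,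
which in the norm case exists by the maximum modulus principle, and adds to `f` a small multiple
of such a power times a vector aligned with the value of `f` there (`dense_nearlyPeaking`).

Finally `A_u(B_X : X)` is complete, since a uniform limit of holomorphic maps is holomorphic
(by the Schwarz lemma their derivatives converge locally uniformly), and Baire's theorem applies.
-/

/-! ### Holomorphic limits and completeness -/

/-- A uniform limit of holomorphic maps on an open subset of a complex normed space is holomorphic.
The Schwarz lemma turns the uniform Cauchy condition for the maps into one for their derivatives on
smaller balls. -/
theorem DifferentiableOn.of_tendstoUniformlyOn_complex {E F : Type*} [NormedAddCommGroup E]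
    [NormedSpace ℂ E] [NormedAddCommGroup F] [NormedSpace ℂ F] [CompleteSpace F]
    {f : ℕ → E → F} {g : E → F} {s : Set E} (hs : IsOpen s)
    (hf : ∀ n, DifferentiableOn ℂ (f n) s) (h : TendstoUniformlyOn f g atTop s) :
    DifferentiableOn ℂ g s := by
  intro x hx
  obtain ⟨R, hR, hRs⟩ := Metric.isOpen_iff.1 hs x hx
  set r := R / 2 with hr
  have hr0 : 0 < r := by positivity
  have hsub : ∀ y ∈ ball x r, ball y r ⊆ s := fun y hy z hz => hRs <| by
    rw [mem_ball] at *
    linarith [dist_triangle z y x]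
  have hxs : ball x r ⊆ s := (ball_subset_ball (by linarith)).trans hRs
  have hcauchy : UniformCauchySeqOn (fun n => fderiv ℂ (f n)) atTop (ball x r) := by
    rw [Metric.uniformCauchySeqOn_iff]
    intro ε hε
    have hε' : 0 < ε * r / 8 := by positivity
    obtain ⟨N, hN⟩ := Metric.uniformCauchySeqOn_iff.1 h.uniformCauchySeqOn _ hε'
    refine ⟨N, fun m hm n hn y hy => ?_⟩
    have hys : y ∈ s := hxs hy
    have hd : DifferentiableOn ℂ (f m - f n) (ball y r) :=
      ((hf m).sub (hf n)).mono (hsub y hy)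
    have hmap : MapsTo (f m - f n) (ball y r) (closedBall ((f m - f n) y) (ε * r / 4)) := by
      intro z hz
      have h1 := hN m hm n hn z (hsub y hy hz)
      have h2 := hN m hm n hn y hys
      rw [dist_eq_norm] at h1 h2
      rw [mem_closedBall, dist_eq_norm]
      calc ‖(f m - f n) z - (f m - f n) y‖ ≤ ‖f m z - f n z‖ + ‖f m y - f n y‖ := norm_sub_le _ _
        _ ≤ ε * r / 4 := by linarith
    have hb := Complex.norm_fderiv_le_div_of_mapsTo_ball hd hmap hr0
    rw [fderiv_sub ((hf m).differentiableAt (hs.mem_nhds hys))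
      ((hf n).differentiableAt (hs.mem_nhds hys))] at hb
    rw [dist_eq_norm]
    refine hb.trans_lt ?_
    rw [div_lt_iff₀ hr0]
    nlinarith [mul_pos hε hr0]
  have hlim : ∀ y ∈ ball x r, ∃ L, Tendsto (fun n => fderiv ℂ (f n) y) atTop (𝓝 L) := fun y hy =>
    cauchySeq_tendsto_of_complete (hcauchy.cauchySeq hy)
  choose! g' hg' using hlim
  exact (hasFDerivAt_of_tendstoUniformlyOn isOpen_ball
    (hcauchy.tendstoUniformlyOn_of_tendsto hg')
    (fun n y hy => ((hf n).differentiableAt (hs.mem_nhds (hxs hy))).hasFDerivAt)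
    (fun y hy => h.tendsto_at (hxs hy)) (mem_ball_self hr0)).differentiableAt.differentiableWithinAt

section Space

variable {X : Type*} [NormedAddCommGroup X] [NormedSpace ℂ X]

theorem isClosed_unifHolBall [CompleteSpace X] : IsClosed (UnifHolBall X : Set (UnitBall X →ᵇ X)) := by
  rw [← isSeqClosed_iff_isClosed]
  intro F f hF hlim
  have hu := BoundedContinuousFunction.tendsto_iff_tendstoUniformly.1 hlim
  refine ⟨?_, hu.uniformContinuous (Frequently.of_forall fun n => (hF n).2)⟩
  refine DifferentiableOn.of_tendstoUniformlyOn_complex isOpen_interior (fun n => (hF n).1) ?_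
  rw [Metric.tendstoUniformlyOn_iff]
  intro ε hε
  filter_upwards [Metric.tendstoUniformly_iff.1 hu ε hε] with n hn x hx
  rw [extend_val_apply _ (interior_subset hx), extend_val_apply _ (interior_subset hx)]
  exact hn _

instance instCompleteSpaceUnifHolBall [CompleteSpace X] : CompleteSpace (UnifHolBall X) :=
  isClosed_unifHolBall.completeSpace_coe

/-! ### The maximum modulus principle -/

/-- Polar decomposition of a vector, with an arbitrary direction when the vector vanishes. -/
theorem exists_norm_eq_one_ofReal_smul [Nontrivial X] (a : X) :
    ∃ e : X, ‖e‖ = 1 ∧ a = ((‖a‖ : ℝ) : ℂ) • e := by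
  by_cases h0 : a = 0
  · obtain ⟨e, he⟩ := NormedSpace.exists_lt_norm ℂ X 0
    refine ⟨((‖e‖⁻¹ : ℝ) : ℂ) • e, ?_, by simp [h0]⟩
    simp [norm_smul, he.ne']
  · have hn : ‖a‖ ≠ 0 := norm_ne_zero_iff.2 h0
    refine ⟨((‖a‖⁻¹ : ℝ) : ℂ) • a, by simp [norm_smul, hn], ?_⟩
    rw [smul_smul, ← Complex.ofReal_mul, mul_inv_cancel₀ hn]
    simp

/-- The sup norm of `f` is its supremum over the unit sphere: apply the one-variable maximum modulus
principle on the complex discs `{c • e : |c| ≤ 1}` with `‖e‖ = 1`. -/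
theorem norm_le_of_forall_sphere_norm_le [CompleteSpace X] [Nontrivial X] (f : HolBall X) {C : ℝ}
    (hC : ∀ x : UnitBall X, ‖(x : X)‖ = 1 → ‖f.1 x‖ ≤ C) : ‖f.1‖ ≤ C := by
  have key : ∀ y : UnitBall X, ‖f.1 y‖ ≤ C := by
    rintro ⟨y, hy⟩
    obtain ⟨e, he, hye⟩ := exists_norm_eq_one_ofReal_smul y
    have hmaps : ∀ c : ℂ, ‖c • e‖ = ‖c‖ := fun c => by rw [norm_smul, he, mul_one]
    let G : X → X := Function.extend (Subtype.val : UnitBall X → X) f.1 0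
    have hGc : ContinuousOn G (closedBall 0 1) := by
      rw [continuousOn_iff_continuous_domRestrict]
      refine f.1.continuous.congr fun x => ?_
      exact (extend_val_apply f.1 x.2).symm
    have hd : DiffContOnCl ℂ (fun c : ℂ => G (c • e)) (ball 0 1) := by
      refine ⟨?_, ?_⟩
      · refine DifferentiableOn.comp (t := interior (closedBall (0 : X) 1)) f.2
          (by fun_prop) fun c hc => ball_subset_interior_closedBall ?_
        rw [mem_ball_zero_iff] at hc ⊢
        rwa [hmaps]
      · refine ContinuousOn.comp hGc (by fun_prop) fun c hc => ?_
        have := closure_ball_subset_closedBall hc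
        rw [mem_closedBall_zero_iff] at this ⊢
        rwa [hmaps]
    have hy1 : ‖y‖ ≤ 1 := mem_closedBall_zero_iff.1 hy
    have := Complex.norm_le_of_forall_mem_frontier_norm_le (C := C) isBounded_ball hd
      (z := ((‖y‖ : ℝ) : ℂ)) ?_ ?_
    · have h2 : G ((((‖y‖ : ℝ) : ℂ)) • e) = f.1 ⟨y, hy⟩ := by
        rw [← hye]; exact extend_val_apply _ hy
      simpa only [h2] using this
    · intro c hc
      rw [frontier_ball _ one_ne_zero, mem_sphere_zero_iff_norm] at hc
      have hm : c • e ∈ closedBall (0 : X) 1 := by rw [mem_closedBall_zero_iff, hmaps, hc]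
      change ‖G (c • e)‖ ≤ C
      rw [show G (c • e) = f.1 ⟨c • e, hm⟩ from extend_val_apply _ hm]
      exact hC _ (by rw [hmaps, hc])
    · rw [closure_ball _ one_ne_zero, mem_closedBall_zero_iff]
      simpa using hy1
  have h0 : (0 : X) ∈ closedBall (0 : X) 1 := by simp
  exact (BoundedContinuousFunction.norm_le ((norm_nonneg _).trans (key ⟨0, h0⟩))).2 key

/-! ### Peak functions from local uniform convexity -/

/-- Local uniform convexity at `x`, with the second vector ranging over the ball instead of the
sphere. -/
theorem IsLocallyUniformlyConvex.exists_norm_add_le (hluc : IsLocallyUniformlyConvex X) {x : X}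
    (hx : ‖x‖ = 1) {η : ℝ} (hη : 0 < η) :
    ∃ δ : ℝ, 0 < δ ∧ ∀ y : X, ‖y‖ ≤ 1 → η ≤ ‖x - y‖ → ‖x + y‖ ≤ 2 - δ := by
  obtain ⟨δ, hδ, H⟩ := hluc x hx (η / 2) (by positivity)
  refine ⟨min (δ / 2) (η / 2), by positivity, fun y hy hxy => ?_⟩
  have hm1 := min_le_left (δ / 2) (η / 2)
  have hm2 := min_le_right (δ / 2) (η / 2)
  have hm0 : 0 < min (δ / 2) (η / 2) := by positivity
  rcases le_or_gt ‖y‖ (1 - min (δ / 2) (η / 2)) with h | h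
  · linarith [norm_add_le x y]
  by_cases h0 : y = 0
  · subst h0
    -- `min (δ / 2) (η / 2) > 1` cannot happen for `y = 0`, since `η ≤ ‖x‖ = 1`
    rw [sub_zero, hx] at hxy
    rw [norm_zero] at h
    linarith
  have hn : 0 < ‖y‖ := norm_pos_iff.2 h0
  -- `‖y‖` is within `min (δ / 2) (η / 2)` of `1`, so `y` may be replaced by its normalization `z`
  set z : X := ((‖y‖⁻¹ : ℝ) : ℂ) • y with hz
  have hz1 : ‖z‖ = 1 := by simp [hz, norm_smul, hn.ne']
  have hyz : ‖y - z‖ = 1 - ‖y‖ := by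
    have : z - y = ((‖y‖⁻¹ - 1 : ℝ) : ℂ) • y := by
      rw [hz, Complex.ofReal_sub, sub_smul, Complex.ofReal_one, one_smul]
    have h1 : 1 ≤ ‖y‖⁻¹ := (one_le_inv₀ hn).2 hy
    rw [norm_sub_rev, this, norm_smul, Complex.norm_real, Real.norm_of_nonneg (by linarith),
      sub_mul, inv_mul_cancel₀ hn.ne', one_mul]
  have hxz : η / 2 ≤ ‖x - z‖ := by
    have := norm_sub_le_norm_sub_add_norm_sub x z y
    rw [norm_sub_rev z y] at this
    linarith
  have h2 := H z hz1 hxz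
  have h3 : ‖x + y‖ ≤ ‖x + z‖ + ‖y - z‖ := by
    calc ‖x + y‖ = ‖(x + z) + (y - z)‖ := by congr 1; abel
      _ ≤ _ := norm_add_le _ _
  linarith

/-- Every unit vector `x` is a peak point: there is `h = g • u` in `A_u(B_X : X)` with `g` scalar,
`g x = 1`, `‖h‖ ≤ 1`, and `|g| ≤ 1 / 2` outside the ball of radius `η` about `x`. -/
theorem exists_peak_unifHolBall (hluc : IsLocallyUniformlyConvex X) (x : UnitBall X)
    (hx : ‖(x : X)‖ = 1) {φ : StrongDual ℂ X} (hφ : ‖φ‖ ≤ 1) (hφx : φ x = 1) {u : X}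
    (hu : ‖u‖ ≤ 1) {η : ℝ} (hη : 0 < η) :
    ∃ (h : UnifHolBall X) (g : UnitBall X → ℂ), ‖h‖ ≤ 1 ∧ (∀ y, h.1 y = g y • u) ∧ g x = 1 ∧
      ∀ y, η ≤ dist y x → ‖g y‖ ≤ 1 / 2 := by
  obtain ⟨δ, hδ, H⟩ := hluc.exists_norm_add_le hx hη
  set q : X → ℂ := fun y => (1 + φ y) / 2 with hq
  have hqb : ∀ y : UnitBall X, ‖q y‖ ≤ ‖(x : X) + y‖ / 2 := by
    intro y
    have h1 : (1 : ℂ) + φ y = φ ((x : X) + y) := by rw [map_add, hφx]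
    have h2 : ‖q y‖ = ‖φ ((x : X) + y)‖ / 2 := by simp [hq, h1]
    rw [h2]
    have := φ.le_of_opNorm_le hφ ((x : X) + y)
    linarith
  have hball : ∀ y : UnitBall X, ‖(y : X)‖ ≤ 1 := fun y => mem_closedBall_zero_iff.1 y.2
  have hq1 : ∀ y : UnitBall X, ‖q y‖ ≤ 1 := fun y => by
    linarith [hqb y, norm_add_le (x : X) y, hball y]
  -- `1 - δ / 2` bounds `‖q‖` away from `x`; it may be negative when no such points exist
  set c : ℝ := max 0 (1 - δ / 2) with hc
  have hc0 : 0 ≤ c := le_max_left _ _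
  have hc1 : c < 1 := max_lt one_pos (by linarith)
  obtain ⟨N, hN⟩ := exists_pow_lt_of_lt_one (show (0 : ℝ) < 1 / 2 by norm_num) hc1
  have hquc : UniformContinuous fun y : UnitBall X => q y := by
    have : UniformContinuous fun y : UnitBall X => φ y :=
      φ.uniformContinuous.comp uniformContinuous_subtype_val
    simpa only [hq, div_eq_inv_mul] using (uniformContinuous_const.add this).const_mul' (2 : ℂ)⁻¹
  have hpuc : UniformContinuous fun y : UnitBall X => q y ^ N := by
    have h1 : UniformContinuousOn (fun z : ℂ => z ^ N) (closedBall 0 1) :=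
      (isCompact_closedBall 0 1).uniformContinuousOn_of_continuous (by fun_prop)
    have h2 := h1.comp (f := fun y : UnitBall X => q y) (s := univ)
      (uniformContinuousOn_univ.2 hquc) fun y _ => mem_closedBall_zero_iff.2 (hq1 y)
    exact uniformContinuousOn_univ.1 h2
  have huc : UniformContinuous fun y : UnitBall X => q y ^ N • u :=
    (((ContinuousLinearMap.id ℂ ℂ).smulRight u).uniformContinuous).comp hpuc
  have hb : ∀ y : UnitBall X, ‖q y ^ N • u‖ ≤ 1 := fun y => by
    rw [norm_smul, norm_pow]
    exact mul_le_one₀ (pow_le_one₀ (norm_nonneg _) (hq1 y)) (norm_nonneg _) hu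
  let F : UnitBall X →ᵇ X := BoundedContinuousFunction.ofNormedAddCommGroup _ huc.continuous 1 hb
  have hF : F ∈ UnifHolBall X := by
    refine ⟨?_, huc⟩
    have hd : Differentiable ℂ fun y : X => q y ^ N • u := by
      simp only [hq]; fun_prop
    refine hd.differentiableOn.congr fun y hy => ?_
    rw [extend_val_apply _ (interior_subset hy)]
    rfl
  refine ⟨⟨F, hF⟩, fun y => q y ^ N,
    BoundedContinuousFunction.norm_ofNormedAddCommGroup_le _ zero_le_one hb, fun y => rfl, ?_, ?_⟩
  · have : q x = 1 := by simp only [hq, hφx]; norm_num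
    simp [this]
  · intro y hy
    have h1 : ‖q y‖ ≤ c := by
      refine le_trans ?_ (le_max_right _ _)
      have := H y (hball y) (by rwa [dist_comm, Subtype.dist_eq, dist_eq_norm] at hy)
      linarith [hqb y]
    rw [norm_pow]
    exact (pow_le_pow_left₀ (norm_nonneg _) h1 N).trans hN.le

end Space

/-! ### Strongly attained suprema -/

section Sup

variable {E P Z : Type*} [PseudoMetricSpace Z]

/-- Those `f` for which the values `val f p` stay away from their supremum as soon as the
position `pos p` is at distance at least `η` from a suitable point `z`. -/
def nearlyPeaking (val : E → P → ℝ) (pos : P → Z) (η : ℝ) : Set E :=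
  {f | ∃ z : Z, ∃ r < ⨆ p, val f p, ∀ p, η ≤ dist (pos p) z → val f p ≤ r}

variable {val : E → P → ℝ} {pos : P → Z}

/-- The supremum of `val f` is `1`-Lipschitz in `f`. -/
theorem iSup_le_iSup_add_norm_sub [NormedAddCommGroup E] [Nonempty P]
    (hbdd : ∀ f, BddAbove (range (val f))) (hlip : ∀ f g p, val f p ≤ val g p + ‖f - g‖) (f g : E) :
    ⨆ p, val f p ≤ (⨆ p, val g p) + ‖f - g‖ :=
  ciSup_le fun p => (hlip f g p).trans (add_le_add_left (le_ciSup (hbdd g) p) _)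

theorem isOpen_nearlyPeaking [NormedAddCommGroup E] [Nonempty P]
    (hbdd : ∀ f, BddAbove (range (val f))) (hlip : ∀ f g p, val f p ≤ val g p + ‖f - g‖) (η : ℝ) :
    IsOpen (nearlyPeaking val pos η) := by
  rw [Metric.isOpen_iff]
  rintro f ⟨z, r, hr, hp⟩
  refine ⟨((⨆ p, val f p) - r) / 2, by linarith, fun g hg => ?_⟩
  rw [mem_ball, dist_eq_norm] at hg
  have h1 := iSup_le_iSup_add_norm_sub hbdd hlip f g
  rw [norm_sub_rev] at h1
  exact ⟨z, r + ‖g - f‖, by linarith, fun p hd => by linarith [hlip g f p, hp p hd]⟩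

theorem exists_tendsto_iSup [Nonempty P] {v : P → ℝ} (hbdd : BddAbove (range v)) :
    ∃ u : ℕ → P, Tendsto (fun n => v (u n)) atTop (𝓝 (⨆ p, v p)) := by
  obtain ⟨w, -, hw, hmem⟩ := exists_seq_tendsto_sSup (range_nonempty v) hbdd
  choose u hu using hmem
  exact ⟨u, by simp only [hu]; exact hw⟩

/-- `f` is nearly peaking at every scale if and only if the positions of all maximizing sequences
converge to one point. -/
theorem forall_mem_nearlyPeaking_iff [Nonempty P] [CompleteSpace Z]
    (hbdd : ∀ f, BddAbove (range (val f))) (f : E) :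
    (∀ n : ℕ, f ∈ nearlyPeaking val pos (1 / ((n : ℝ) + 1))) ↔
      ∃ z : Z, ∀ u : ℕ → P, Tendsto (fun n => val f (u n)) atTop (𝓝 (⨆ p, val f p)) →
        Tendsto (fun n => pos (u n)) atTop (𝓝 z) := by
  constructor
  -- a maximizing sequence eventually lies in the ball of radius `1 / (n + 1)` about the `n`-th point
  · intro h
    have key : ∀ ε > 0, ∃ z : Z, ∀ u : ℕ → P,
        Tendsto (fun n => val f (u n)) atTop (𝓝 (⨆ p, val f p)) →
          ∀ᶠ n in atTop, dist (pos (u n)) z < ε := by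
      intro ε hε
      obtain ⟨n, hn⟩ := exists_nat_one_div_lt hε
      obtain ⟨z, r, hr, hp⟩ := h n
      refine ⟨z, fun u hu => ?_⟩
      filter_upwards [hu.eventually_const_lt hr] with k hk
      by_contra! hcon
      exact absurd (hp (u k) (hn.le.trans hcon)) (not_le.2 hk)
    obtain ⟨u₀, hu₀⟩ := exists_tendsto_iSup (hbdd f)
    have hcauchy : CauchySeq fun n => pos (u₀ n) := by
      rw [Metric.cauchySeq_iff']
      intro ε hε
      obtain ⟨z, hz⟩ := key (ε / 2) (by positivity)
      obtain ⟨N, hN⟩ := eventually_atTop.1 (hz u₀ hu₀)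
      exact ⟨N, fun n hn => by
        linarith [dist_triangle_right (pos (u₀ n)) (pos (u₀ N)) z, hN n hn, hN N le_rfl]⟩
    obtain ⟨z, hz⟩ := cauchySeq_tendsto_of_complete hcauchy
    refine ⟨z, fun u hu => (tendsto_iff_of_dist ?_).1 hz⟩
    rw [Metric.tendsto_atTop']
    intro ε hε
    obtain ⟨w, hw⟩ := key (ε / 2) (by positivity)
    obtain ⟨N, hN⟩ := eventually_atTop.1 ((hw u₀ hu₀).and (hw u hu))
    refine ⟨N, fun n hn => ?_⟩
    rw [Real.dist_0_eq_abs, abs_of_nonneg dist_nonneg]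
    linarith [dist_triangle_right (pos (u₀ n)) (pos (u n)) w, hN n hn.le]
  · rintro ⟨z, hz⟩ n
    refine ⟨z, ?_⟩
    by_contra! hcon
    -- otherwise some maximizing sequence stays at distance `1 / (n + 1)` from `z`
    have hr : ∀ k : ℕ, (⨆ p, val f p) - 1 / ((k : ℝ) + 1) < ⨆ p, val f p := fun k =>
      sub_lt_self _ Nat.one_div_pos_of_nat
    choose u hu1 hu2 using fun k : ℕ => hcon _ (hr k)
    have hlow : Tendsto (fun k : ℕ => (⨆ p, val f p) - 1 / ((k : ℝ) + 1)) atTop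
        (𝓝 (⨆ p, val f p)) := by
      simpa using tendsto_const_nhds.sub (tendsto_one_div_add_atTop_nhds_zero_nat (𝕜 := ℝ))
    have hlim := hz u (tendsto_of_tendsto_of_tendsto_of_le_of_le hlow tendsto_const_nhds
      (fun k => (hu2 k).le) fun k => le_ciSup (hbdd f) (u k))
    obtain ⟨k, hk⟩ := (hlim.eventually (ball_mem_nhds z
      (Nat.one_div_pos_of_nat (α := ℝ) (n := n)))).exists
    exact absurd (hu1 k) (not_le.2 hk)

/-- Density follows if at some almost maximizing point there is a direction `h` along which the value
at that point grows at full speed, while far from it values grow at most at half speed. -/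
theorem dense_nearlyPeaking [NormedAddCommGroup E] [NormedSpace ℂ E]
    (hbdd : ∀ f, BddAbove (range (val f))) {η : ℝ}
    (hpeak : ∀ f, ∀ δ > 0, ∃ (p : P) (h : E), (⨆ q, val f q) - δ < val f p ∧ ‖h‖ ≤ 1 ∧
      ∀ ε : ℝ, 0 ≤ ε → val f p + ε ≤ val (f + (ε : ℂ) • h) p ∧
        ∀ q, η ≤ dist (pos q) (pos p) → val (f + (ε : ℂ) • h) q ≤ val f q + ε / 2) :
    Dense (nearlyPeaking val pos η) := by
  rw [Metric.dense_iff]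
  intro f ρ hρ
  set ε : ℝ := ρ / 2 with hε
  have hε0 : 0 < ε := by positivity
  obtain ⟨p, h, hp, hh, H⟩ := hpeak f (ε / 2) (by positivity)
  obtain ⟨H1, H2⟩ := H ε hε0.le
  refine ⟨f + (ε : ℂ) • h, ?_, pos p, (⨆ q, val f q) + ε / 2, ?_, fun q hq => ?_⟩
  · rw [mem_ball, dist_eq_norm, add_sub_cancel_left, norm_smul, Complex.norm_real,
      Real.norm_of_nonneg hε0.le]
    nlinarith
  · have := le_ciSup (hbdd (f + (ε : ℂ) • h)) p
    linarith
  · linarith [H2 q hq, le_ciSup (hbdd f) q]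

end Sup

/-! ### The space `Π(X)` over a smooth space -/

section Numerical

variable {X : Type*} [NormedAddCommGroup X] [NormedSpace ℂ X]

theorem numPi_norm_toStrongDual_le (p : numPi X) : ‖WeakDual.toStrongDual p.1.2‖ ≤ 1 :=
  mem_closedBall_zero_iff.1 p.2.2.1

theorem numPi_norm_apply_le (p : numPi X) (y : X) : ‖p.1.2 y‖ ≤ ‖y‖ := by
  simpa using (WeakDual.toStrongDual p.1.2).le_of_opNorm_le (numPi_norm_toStrongDual_le p) y

theorem numPi_norm_fst (p : numPi X) : ‖p.1.1‖ = 1 := by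
  refine le_antisymm (mem_closedBall_zero_iff.1 p.2.1) ?_
  have := numPi_norm_apply_le p p.1.1
  rwa [p.2.2.2, norm_one] at this

/-- The first projection `Π(X) → S_X`. -/
def numPi_point (p : numPi X) : sphere (0 : X) 1 :=
  ⟨p.1.1, mem_sphere_zero_iff_norm.2 (numPi_norm_fst p)⟩

theorem numPi_point_surjective : Function.Surjective (numPi_point (X := X)) := by
  rintro ⟨x, hx⟩
  rw [mem_sphere_zero_iff_norm] at hx
  obtain ⟨φ, hφ, hφx⟩ := exists_dual_vector'' ℂ x
  refine ⟨⟨(x, StrongDual.toWeakDual φ), mem_closedBall_zero_iff.2 hx.le,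
    mem_closedBall_zero_iff.2 hφ, ?_⟩, rfl⟩
  change φ x = 1
  simpa [hx] using hφx

theorem nonempty_numPi [Nontrivial X] : Nonempty (numPi X) := by
  obtain ⟨e, he, -⟩ := exists_norm_eq_one_ofReal_smul (0 : X)
  exact ⟨(numPi_point_surjective ⟨e, mem_sphere_zero_iff_norm.2 he⟩).choose⟩

/-- Over a smooth space, convergence in `Π(X)` amounts to norm convergence of the first coordinates:
a weak-* cluster point of the functionals is a norming functional of the limit point, and hence is
unique. -/
theorem IsSmoothSpace.tendsto_numPi_iff (hsmooth : IsSmoothSpace X) {u : ℕ → numPi X}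
    {t : numPi X} :
    Tendsto u atTop (𝓝 t) ↔ Tendsto (fun n => numPi_point (u n)) atTop (𝓝 (numPi_point t)) := by
  have hfst : Tendsto (fun n => numPi_point (u n)) atTop (𝓝 (numPi_point t)) ↔
      Tendsto (fun n => (u n).1.1) atTop (𝓝 t.1.1) := tendsto_subtype_rng
  rw [hfst, tendsto_subtype_rng, nhds_prod_eq]
  refine ⟨fun h => tendsto_fst.comp h, fun h => ?_⟩
  refine Tendsto.prodMk (f := atTop) (g := 𝓝 t.1.1) (h := 𝓝 t.1.2) h ?_
  refine (WeakDual.isCompact_closedBall (0 : StrongDual ℂ X) 1).tendsto_nhds_of_unique_mapClusterPt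
    (Eventually.of_forall fun n => (u n).2.2.1) fun φ hφ hcl => ?_
  have hev : Tendsto (fun n => (u n).1.2 t.1.1) atTop (𝓝 1) := by
    have h0 : Tendsto (fun n => ‖(u n).1.1 - t.1.1‖) atTop (𝓝 0) :=
      tendsto_iff_norm_sub_tendsto_zero.1 h
    rw [tendsto_iff_norm_sub_tendsto_zero]
    refine squeeze_zero (fun n => norm_nonneg _) (fun n => ?_) h0
    rw [norm_sub_rev, ← (u n).2.2.2, ← map_sub]
    exact (numPi_norm_apply_le (u n)) _
  have hcl' : MapClusterPt (φ t.1.1) atTop fun n => (u n).1.2 t.1.1 :=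
    hcl.continuousAt_comp (WeakDual.eval_continuous t.1.1).continuousAt
  have hφ1 : φ t.1.1 = 1 := by
    have : ClusterPt (φ t.1.1) (𝓝 (1 : ℂ)) := ClusterPt.mono hcl' hev
    exact (eq_of_nhds_neBot this)
  have hmem : t.1.1 ∈ smoothPoints X := by
    rw [hsmooth]
    exact mem_sphere_zero_iff_norm.2 (numPi_norm_fst t)
  have := hmem.2.unique (y₁ := WeakDual.toStrongDual φ) (y₂ := WeakDual.toStrongDual t.1.2)
    ⟨hφ, by simp [hφ1]⟩ ⟨t.2.2.1, by simp [t.2.2.2]⟩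
  exact WeakDual.toStrongDual.injective this

theorem numValue_le_norm (f : UnitBall X →ᵇ X) (p : numPi X) : numValue f p ≤ ‖f‖ :=
  (numPi_norm_apply_le p _).trans (f.norm_coe_le_norm _)

theorem bddAbove_range_numValue (f : UnitBall X →ᵇ X) : BddAbove (range (numValue f)) :=
  ⟨‖f‖, by rintro _ ⟨p, rfl⟩; exact numValue_le_norm f p⟩

theorem numValue_add_le (f g : UnitBall X →ᵇ X) (p : numPi X) :
    numValue (f + g) p ≤ numValue f p + numValue g p := by
  simp only [numValue, BoundedContinuousFunction.add_apply, map_add]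
  exact norm_add_le _ _

end Numerical

/-! ### Genericity of the two kinds of peak functions -/

section Main

variable {X : Type*} [NormedAddCommGroup X] [NormedSpace ℂ X]

theorem bddAbove_range_norm_apply {K Y : Type*} [TopologicalSpace K] [SeminormedAddCommGroup Y]
    (f : K →ᵇ Y) : BddAbove (range fun x => ‖f x‖) :=
  ⟨‖f‖, by rintro _ ⟨x, rfl⟩; exact f.norm_coe_le_norm x⟩

theorem isStrongPeakFunction_iff_forall_nearlyPeaking [CompleteSpace X] [Nontrivial X]
    (f : UnifHolBall X) :
    IsStrongPeakFunction (f : UnitBall X →ᵇ X) ↔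
      ∀ n : ℕ, f ∈ nearlyPeaking (fun (f : UnifHolBall X) (x : UnitBall X) => ‖f.1 x‖) id
        (1 / ((n : ℝ) + 1)) := by
  have : CompleteSpace (UnitBall X) := isClosed_closedBall.completeSpace_coe
  have hiff := forall_mem_nearlyPeaking_iff
    (val := fun (f : UnifHolBall X) (x : UnitBall X) => ‖f.1 x‖) (pos := id)
    (fun f => bddAbove_range_norm_apply f.1) f
  rw [← BoundedContinuousFunction.norm_eq_iSup_norm] at hiff
  refine ⟨fun h => hiff.2 h.2, fun h => ⟨fun h0 => ?_, hiff.1 h⟩⟩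
  -- for `f = 0` the condition at scale `1` would put the whole ball, which has diameter `2`,
  -- inside an open ball of radius `1`
  obtain ⟨z, r, hr, hz⟩ := h 0
  simp only [h0, BoundedContinuousFunction.coe_zero, Pi.zero_apply, norm_zero, ciSup_const] at hr hz
  obtain ⟨e, he, -⟩ := exists_norm_eq_one_ofReal_smul (0 : X)
  have hlt : ∀ y : UnitBall X, ‖(y : X) - z‖ < 1 := fun y => by
    by_contra! hcon
    refine absurd (hz y ?_) (not_le.2 hr)
    simpa [Subtype.dist_eq, dist_eq_norm] using hcon
  have h1 := hlt ⟨e, mem_closedBall_zero_iff.2 he.le⟩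
  have h2 := hlt ⟨-e, mem_closedBall_zero_iff.2 (by rw [norm_neg, he])⟩
  have h3 : ‖(2 : ℂ) • e‖ ≤ ‖e - z‖ + ‖-e - z‖ := by
    have : (2 : ℂ) • e = (e - z) - (-e - z) := by rw [two_smul]; abel
    rw [this]
    exact norm_sub_le _ _
  rw [norm_smul, he] at h3
  norm_num at h3
  linarith

theorem isOpen_nearlyPeaking_norm (η : ℝ) :
    IsOpen (nearlyPeaking (fun (f : UnifHolBall X) (x : UnitBall X) => ‖f.1 x‖) id η) := by
  have : Nonempty (UnitBall X) := ⟨⟨0, by simp⟩⟩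
  refine isOpen_nearlyPeaking
    (val := fun (f : UnifHolBall X) (x : UnitBall X) => ‖f.1 x‖)
    (fun f => bddAbove_range_norm_apply f.1) (fun f g x => ?_) η
  have h1 := norm_le_norm_add_norm_sub' (f.1 x) (g.1 x)
  have h2 := (f.1 - g.1).norm_coe_le_norm x
  exact h1.trans (add_le_add_right h2 _)

theorem dense_nearlyPeaking_norm [CompleteSpace X] [Nontrivial X]
    (hluc : IsLocallyUniformlyConvex X) {η : ℝ} (hη : 0 < η) :
    Dense (nearlyPeaking (fun (f : UnifHolBall X) (x : UnitBall X) => ‖f.1 x‖) id η) := by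
  refine dense_nearlyPeaking
    (val := fun (f : UnifHolBall X) (x : UnitBall X) => ‖f.1 x‖)
    (fun f => bddAbove_range_norm_apply f.1) fun f δ hδ => ?_
  obtain ⟨x, hx, hfx⟩ : ∃ x : UnitBall X, ‖(x : X)‖ = 1 ∧ ‖f.1‖ - δ < ‖f.1 x‖ := by
    by_contra! hcon
    linarith [norm_le_of_forall_sphere_norm_le ⟨f.1, f.2.1⟩ hcon]
  obtain ⟨φ, hφ, hφx⟩ := exists_dual_vector'' ℂ (x : X)
  obtain ⟨e, he, hfe⟩ := exists_norm_eq_one_ofReal_smul (f.1 x)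
  obtain ⟨h, g, hh, hg, hgx, hgη⟩ :=
    exists_peak_unifHolBall hluc x hx hφ (by simpa [hx] using hφx) he.le hη
  refine ⟨x, h, by rwa [← BoundedContinuousFunction.norm_eq_iSup_norm], hh, fun ε hε => ⟨?_, ?_⟩⟩
  · have : (f + (ε : ℂ) • h).1 x = ((‖f.1 x‖ + ε : ℝ) : ℂ) • e := by
      change f.1 x + (ε : ℂ) • h.1 x = _
      rw [hg, hgx, one_smul, Complex.ofReal_add, add_smul, ← hfe]
    simp only [this, norm_smul, he, Complex.norm_real, mul_one]
    exact le_abs_self _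
  · intro y hy
    change ‖f.1 y + (ε : ℂ) • h.1 y‖ ≤ _
    refine (norm_add_le _ _).trans (add_le_add_right ?_ _)
    rw [hg, norm_smul, norm_smul, he, Complex.norm_real, Real.norm_of_nonneg hε, mul_one]
    nlinarith [hgη y hy]

theorem IsSmoothSpace.isNumericalStrongPeakFunction_iff_forall_nearlyPeaking [CompleteSpace X]
    [Nontrivial X] (hsmooth : IsSmoothSpace X) (f : UnifHolBall X) :
    IsNumericalStrongPeakFunction (f : UnitBall X →ᵇ X) ↔
      ∀ n : ℕ, f ∈ nearlyPeaking (fun (f : UnifHolBall X) => numValue f.1) numPi_point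
        (1 / ((n : ℝ) + 1)) := by
  have : CompleteSpace (sphere (0 : X) 1) := isClosed_sphere.completeSpace_coe
  have : Nonempty (numPi X) := nonempty_numPi
  rw [forall_mem_nearlyPeaking_iff (val := fun (f : UnifHolBall X) => numValue f.1)
    (fun f => bddAbove_range_numValue f.1),
    numPi_point_surjective.exists]
  simp only [← hsmooth.tendsto_numPi_iff]
  rfl

theorem isOpen_nearlyPeaking_numValue [Nontrivial X] (η : ℝ) :
    IsOpen (nearlyPeaking (fun (f : UnifHolBall X) => numValue f.1) numPi_point η) := by
  have : Nonempty (numPi X) := nonempty_numPi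
  refine isOpen_nearlyPeaking (val := fun (f : UnifHolBall X) => numValue f.1)
    (fun f => bddAbove_range_numValue f.1) (fun f g p => ?_) η
  calc numValue f.1 p = numValue (g.1 + (f.1 - g.1)) p := by rw [add_sub_cancel]
    _ ≤ numValue g.1 p + numValue (f.1 - g.1) p := numValue_add_le _ _ _
    _ ≤ numValue g.1 p + ‖f - g‖ := add_le_add_right (numValue_le_norm _ _) _

theorem dense_nearlyPeaking_numValue [Nontrivial X] (hluc : IsLocallyUniformlyConvex X) {η : ℝ}
    (hη : 0 < η) :
    Dense (nearlyPeaking (fun (f : UnifHolBall X) => numValue f.1) numPi_point η) := by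
  have : Nonempty (numPi X) := nonempty_numPi
  refine dense_nearlyPeaking (val := fun (f : UnifHolBall X) => numValue f.1)
    (fun f => bddAbove_range_numValue f.1) fun f δ hδ => ?_
  obtain ⟨p, hp⟩ := exists_lt_of_lt_ciSup (sub_lt_self (⨆ q, numValue f.1 q) hδ)
  set x : UnitBall X := ⟨p.1.1, p.2.1⟩ with hx
  have hx1 : ‖(x : X)‖ = 1 := numPi_norm_fst p
  -- `h` takes the value `c • x` at `x`, so that `p` maps it to `c`, aligned with the value of `f`
  obtain ⟨c, hc, hfc⟩ := exists_norm_eq_one_ofReal_smul (p.1.2 (f.1 x))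
  have hcx : ‖c • (x : X)‖ = 1 := by rw [norm_smul, hc, hx1, mul_one]
  obtain ⟨h, g, hh, hg, hgx, hgη⟩ := exists_peak_unifHolBall hluc x hx1
    (numPi_norm_toStrongDual_le p) p.2.2.2 hcx.le hη
  refine ⟨p, h, hp, hh, fun ε hε => ⟨?_, ?_⟩⟩
  · have : p.1.2 ((f + (ε : ℂ) • h).1 x) = ((numValue f.1 p + ε : ℝ) : ℂ) • c := by
      change p.1.2 (f.1 x + (ε : ℂ) • h.1 x) = _
      rw [hg, hgx, one_smul, map_add, map_smul, map_smul, p.2.2.2, Complex.ofReal_add, add_smul]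
      congr 1
      simp
    change _ ≤ ‖p.1.2 ((f + (ε : ℂ) • h).1 x)‖
    rw [this, norm_smul, hc, Complex.norm_real, mul_one]
    exact le_abs_self _
  · intro q hq
    refine (numValue_add_le f.1 ((ε : ℂ) • h.1) q).trans (add_le_add_right ?_ _)
    set y : UnitBall X := ⟨q.1.1, q.2.1⟩ with hy
    have h1 : ‖(ε : ℂ) • h.1 y‖ ≤ ε / 2 := by
      rw [hg, norm_smul, norm_smul, hcx, Complex.norm_real, Real.norm_of_nonneg hε, mul_one]
      nlinarith [hgη y hq]
    exact (numPi_norm_apply_le q _).trans h1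

end Main

theorem corollary3p3 (X : Type*) [NormedAddCommGroup X] [NormedSpace ℂ X] [CompleteSpace X]
    [Nontrivial X] [TopologicalSpace.SeparableSpace X]
    (hsmooth : IsSmoothSpace X) (hluc : IsLocallyUniformlyConvex X) :
    IsGδ {f : UnifHolBall X | IsStrongPeakFunction (f : UnitBall X →ᵇ X) ∧
        IsNumericalStrongPeakFunction (f : UnitBall X →ᵇ X)} ∧
      Dense {f : UnifHolBall X | IsStrongPeakFunction (f : UnitBall X →ᵇ X) ∧
        IsNumericalStrongPeakFunction (f : UnitBall X →ᵇ X)} := by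
  have hset : {f : UnifHolBall X | IsStrongPeakFunction (f : UnitBall X →ᵇ X) ∧
      IsNumericalStrongPeakFunction (f : UnitBall X →ᵇ X)} =
      ⋂ n : ℕ, nearlyPeaking (fun (f : UnifHolBall X) (x : UnitBall X) => ‖f.1 x‖) id
          (1 / ((n : ℝ) + 1)) ∩
        nearlyPeaking (fun (f : UnifHolBall X) => numValue f.1) numPi_point
          (1 / ((n : ℝ) + 1)) := by
    ext f
    simp only [mem_ofPred_eq, mem_iInter, mem_inter_iff, forall_and,
      isStrongPeakFunction_iff_forall_nearlyPeaking,
      hsmooth.isNumericalStrongPeakFunction_iff_forall_nearlyPeaking]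
  have hopen : ∀ n : ℕ, IsOpen _ := fun n =>
    (isOpen_nearlyPeaking_norm (X := X) (1 / ((n : ℝ) + 1))).inter
      (isOpen_nearlyPeaking_numValue (1 / ((n : ℝ) + 1)))
  rw [hset]
  refine ⟨IsGδ.iInter_of_isOpen hopen, dense_iInter_of_isOpen hopen fun n => ?_⟩
  exact (dense_nearlyPeaking_norm hluc Nat.one_div_pos_of_nat).inter_of_isOpen_left
    (dense_nearlyPeaking_numValue hluc Nat.one_div_pos_of_nat) (isOpen_nearlyPeaking_norm _)
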